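/- \textbf{Theorem (S. Bernstein).} Let $f\colon\mathbb{R}^2\to\mathbb{R}$ be a smooth ($C^\infty$) function whose graph $z=f(x,y)$ in $\mathbb{R}^3$ is strictly saddle, that is, the Gaussian curvature of the graph is negative at every point. Then $f$ is unbounded; that is, there is no constant $C$ such that $|f(x,y)|\le C$ for all $(x,y)\in\mathbb{R}^2$. Here the Gaussian curvature of a smooth surface $\Sigma\subset\mathbb{R}^3$ at a point $p$ is the product $k_1 k_2$ of its principal curvatures. These are defined as follows: in suitable Cartesian coordinates with origin at $p$ and with the tangent plane at $p$ as $(x,y)$-plane, $\Sigma$ is, near $p$, the graph $z=g(x,y)$ of a smooth function $g$ with $g(0,0)=g_x(0,0)=g_y(0,0)=0$ and $g_{xy}(0,0)=0$, and $k_1=g_{xx}(0,0)$, $k_2=g_{yy}(0,0)$. -/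

import Mathlib

open scoped ContDiff

/-- Euclidean space `ℝ³`. -/
abbrev Space : Type := EuclideanSpace ℝ (Fin 3)

/-- The graph `z = f(x, y)` as a subset of `ℝ³`. -/
def graphSurface (f : ℝ × ℝ → ℝ) : Set Space :=
  {q | q 2 = f (q 0, q 1)}

/-- Tangent-normal coordinates of the set `S` at the point `p`: the Cartesian coordinates with
origin `p` and orthonormal axes `b 0, b 1, b 2`, such that in an open neighbourhood `U` of `p` the
set `S` is the graph `z = g(x, y)` of a smooth function `g` on an open set `V ∋ (0, 0)` with
`g(0, 0) = 0` and vanishing first derivative at `(0, 0)`; that is, the tangent plane at `p` is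
the `(x, y)`-plane and `b 2` is a unit normal. -/
structure IsTangentNormalChart (S : Set Space) (p : Space)
    (b : OrthonormalBasis (Fin 3) ℝ Space) (U : Set Space) (V : Set (ℝ × ℝ))
    (g : ℝ × ℝ → ℝ) : Prop where
  isOpen_nhd : IsOpen U
  mem_nhd : p ∈ U
  isOpen_dom : IsOpen V
  zero_mem_dom : (0, 0) ∈ V
  smooth : ContDiffOn ℝ ∞ g V
  map_zero : g (0, 0) = 0
  fderiv_zero : fderiv ℝ g (0, 0) = 0
  inter_eq : S ∩ U = (fun w : ℝ × ℝ => p + w.1 • b 0 + w.2 • b 1 + g w • b 2) '' V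

/-- `k₁` and `k₂` are the principal curvatures (in some order, for some choice of the unit normal)
of `S` at `p`: for suitable tangent-normal coordinates at `p`, the Hessian matrix at `(0, 0)` of the
function `g` whose graph is `S` near `p` is the diagonal matrix with entries `k₁, k₂`. -/
def HasPrincipalCurvaturesAt (S : Set Space) (p : Space) (k₁ k₂ : ℝ) : Prop :=
  ∃ (b : OrthonormalBasis (Fin 3) ℝ Space) (U : Set Space) (V : Set (ℝ × ℝ)) (g : ℝ × ℝ → ℝ),
    IsTangentNormalChart S p b U V g ∧
      fderiv ℝ (fderiv ℝ g) (0, 0) (1, 0) (1, 0) = k₁ ∧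
      fderiv ℝ (fderiv ℝ g) (0, 0) (1, 0) (0, 1) = 0 ∧
      fderiv ℝ (fderiv ℝ g) (0, 0) (0, 1) (0, 1) = k₂

/-- `K` is the Gaussian curvature of `S` at `p`: the product of the principal curvatures. -/
def HasGaussianCurvatureAt (S : Set Space) (p : Space) (K : ℝ) : Prop :=
  ∃ k₁ k₂ : ℝ, HasPrincipalCurvaturesAt S p k₁ k₂ ∧ K = k₁ * k₂

/-- `S` is strictly saddle: its Gaussian curvature is defined and negative at every point. -/
def IsStrictlySaddle (S : Set Space) : Prop :=
  ∀ p ∈ S, ∃ K : ℝ, HasGaussianCurvatureAt S p K ∧ K < 0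

/-!
The first step turns the curvature hypothesis into a statement about `f`. A tangent-normal chart
writes a tangent curve of the graph as a curve in the coordinates of `ℝ³`; differentiating
`z = f(x, y)` twice along it shows that `D²f` at the foot point has the signs of `k₁` and `k₂`, up
to a common nonzero factor, along the projections of the two principal directions
(`IsTangentNormalChart.second_fderiv`). So `D²f` is indefinite everywhere
(`exists_second_fderiv_pos_neg`), and `f` minus a linear function never has a local extremum.

Suppose now that `|f| ≤ C` and let `L` be a nonzero linear function. The set `{f - L > c}` contains
a half plane on which `L` is very negative and is disjoint from one on which `L` is very large. A
component of it that misses the first half plane would lie in a strip, and comparing `f - L - c`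
there with `ε M + const`, where `M` is the linear coordinate along the strip, and letting `ε → 0`
shows that `f - L` attains its maximum over the component, which is impossible. Hence `{f - L > c}`
is connected (`isPreconnected_superlevel`), and so is `{f - L < c}`, by symmetry.

Finally, take a point `p` whose tangent plane is not horizontal and let `L + c` be the affine
function whose graph is that plane. Near `p` the set `{f - L > c}` contains both sides of `p` on one
line and `{f - L < c}` both sides of `p` on another. Two disjoint connected sets, one of them open,
cannot cross in this way (`false_of_cross`). This is akin to the Jordan curve theorem; it is proved
with continuous logarithms of `(z - q) / (z - q')` in place of winding numbers.
-/

open Filter Topology Set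

/-! ### Continuous logarithms and crossing sets in the plane -/

/-- Two continuous logarithms of the same function on a preconnected set differ by a constant. -/
theorem sub_eq_sub_of_exp_eq {X : Type*} [TopologicalSpace X] {S : Set X} (hS : IsPreconnected S)
    {g₁ g₂ : X → ℂ} (h₁ : ContinuousOn g₁ S) (h₂ : ContinuousOn g₂ S)
    (h : ∀ z ∈ S, Complex.exp (g₁ z) = Complex.exp (g₂ z)) {x y : X} (hx : x ∈ S) (hy : y ∈ S) :
    g₁ x - g₂ x = g₁ y - g₂ y := by
  refine hS.induction₂ (fun x y => g₁ x - g₂ x = g₁ y - g₂ y) ?_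
    (fun x y z _ _ _ h1 h2 => h1.trans h2) (fun x y _ _ h1 => h1.symm) hx hy
  intro x hx
  have hc : ContinuousWithinAt (fun z => g₁ z - g₂ z) S x := (h₁.sub h₂) x hx
  filter_upwards [hc.eventually (Metric.ball_mem_nhds _ one_pos), self_mem_nhdsWithin] with y hy hyS
  have hexp : Complex.exp ((g₁ y - g₂ y) - (g₁ x - g₂ x)) = 1 := by
    rw [Complex.exp_sub, Complex.exp_sub, Complex.exp_sub, h y hyS, h x hx]
    simp [Complex.exp_ne_zero]
  obtain ⟨n, hn⟩ := Complex.exp_eq_one_iff.1 hexp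
  rw [dist_eq_norm, hn] at hy
  have hn0 : n = 0 := by
    by_contra hne
    have h1 : (1 : ℝ) ≤ |(n : ℝ)| := by exact_mod_cast Int.one_le_abs hne
    have h2 : ‖(n : ℂ) * (2 * Real.pi * Complex.I)‖ = |(n : ℝ)| * (2 * Real.pi) := by
      simp [abs_of_pos Real.pi_pos]
    rw [h2] at hy
    nlinarith [Real.pi_gt_three]
  rw [hn0] at hn
  simp only [Int.cast_zero, zero_mul] at hn
  exact (sub_eq_zero.1 hn).symm

/-- If `N` is open and preconnected and disjoint from `K`, then for `q, q' ∈ N` the function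
`z ↦ (z - q) / (z - q')` has a continuous logarithm on `K`. -/
theorem exists_continuousOn_log_div {K N : Set ℂ} (hN : IsPreconnected N) (hNo : IsOpen N)
    (hd : ∀ z ∈ K, z ∉ N) {q q' : ℂ} (hq : q ∈ N) (hq' : q' ∈ N) :
    ∃ g : ℂ → ℂ, ContinuousOn g K ∧ ∀ z ∈ K, Complex.exp (g z) = (z - q) / (z - q') := by
  have hne : ∀ z ∈ K, ∀ q ∈ N, z - q ≠ 0 := fun z hz q hq h0 =>
    hd z hz (by rwa [sub_eq_zero.1 h0])
  refine hN.induction₂ (fun q q' => ∃ g : ℂ → ℂ, ContinuousOn g K ∧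
    ∀ z ∈ K, Complex.exp (g z) = (z - q) / (z - q')) ?_ ?_ ?_ hq hq'
  · intro q hq
    obtain ⟨r, hr, hball⟩ := Metric.isOpen_iff.1 hNo q hq
    filter_upwards [mem_nhdsWithin_of_mem_nhds (Metric.ball_mem_nhds q hr), self_mem_nhdsWithin]
      with q' hq'r hq'N
    -- `(z - q') / (z - q)` stays in the unit disc around `1`, where the principal logarithm works
    have hslit : ∀ z ∈ K, (z - q') / (z - q) ∈ Complex.slitPlane := by
      intro z hz
      have hz0 := hne z hz q hq
      have hzr : r ≤ ‖z - q‖ := by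
        by_contra hlt
        exact hd z hz (hball (by rw [Metric.mem_ball, dist_eq_norm]; exact not_le.1 hlt))
      have hqr : ‖q' - q‖ < ‖z - q‖ := by
        rw [← dist_eq_norm]; exact lt_of_lt_of_le hq'r hzr
      have heq : (z - q') / (z - q) = 1 + -((q' - q) / (z - q)) := by
        field_simp; ring
      rw [heq]
      apply Complex.mem_slitPlane_of_norm_lt_one
      rw [norm_neg, norm_div]
      exact (div_lt_one (norm_pos_iff.2 hz0)).2 hqr
    refine ⟨fun z => -Complex.log ((z - q') / (z - q)), ?_, ?_⟩
    · refine (ContinuousOn.clog ?_ hslit).neg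
      exact ContinuousOn.div (by fun_prop) (by fun_prop) fun z hz => hne z hz q hq
    · intro z hz
      rw [Complex.exp_neg, Complex.exp_log (Complex.slitPlane_ne_zero (hslit z hz)), inv_div]
  · rintro x y w _ hy _ ⟨g, hg, hg'⟩ ⟨k, hk, hk'⟩
    refine ⟨fun z => g z + k z, hg.add hk, fun z hz => ?_⟩
    rw [Complex.exp_add, hg' z hz, hk' z hz, div_mul_div_cancel₀ (hne z hz y hy)]
  · rintro x y _ _ ⟨g, hg, hg'⟩
    exact ⟨fun z => -g z, hg.neg, fun z hz => by rw [Complex.exp_neg, hg' z hz, inv_div]⟩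

/-- Two disjoint preconnected sets, one of them open, cannot cross at the origin in such a way that
one contains a punctured interval of the real axis and the other a punctured interval of the
imaginary axis. Otherwise `(z - ri) / (z + ri)` would have a continuous logarithm on the union of
the first set with `[-r, r]`; on the set it is the principal one up to a constant, whereas along
`[-r, r]` the quotient crosses the negative real axis, so the two increments between `-r` and `r`
differ by `2πi`. -/
theorem false_of_cross {P N : Set ℂ} (hP : IsPreconnected P) (hN : IsPreconnected N)
    (hNo : IsOpen N) (hd : ∀ z ∈ P, z ∉ N) (hP0 : (0 : ℂ) ∉ P) (hN0 : (0 : ℂ) ∉ N) {r : ℝ}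
    (hr : 0 < r) (hre : ∀ t : ℝ, t ≠ 0 → |t| ≤ r → (t : ℂ) ∈ P)
    (him : ∀ t : ℝ, t ≠ 0 → |t| ≤ r → (t : ℂ) * Complex.I ∈ N) : False := by
  set J : Set ℂ := Complex.ofReal '' Icc (-r) r with hJ
  have hJc : IsPreconnected J :=
    isPreconnected_Icc.image _ Complex.continuous_ofReal.continuousOn
  have hrP : (r : ℂ) ∈ P := hre r hr.ne' (abs_of_pos hr).le
  have hrP' : ((-r : ℝ) : ℂ) ∈ P := hre (-r) (neg_ne_zero.2 hr.ne') (by rw [abs_neg, abs_of_pos hr])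
  have hq : (r : ℂ) * Complex.I ∈ N := him r hr.ne' (abs_of_pos hr).le
  have hq' : ((-r : ℝ) : ℂ) * Complex.I ∈ N :=
    him (-r) (neg_ne_zero.2 hr.ne') (by rw [abs_neg, abs_of_pos hr])
  have hJN : ∀ z ∈ J, z ∉ N := by
    rintro _ ⟨t, ht, rfl⟩
    by_cases h0 : t = 0
    · simpa [h0] using hN0
    · exact hd _ (hre t h0 (abs_le.2 ht))
  have hKN : ∀ z ∈ P ∪ J, z ∉ N := by
    rintro z (hz | hz)
    exacts [hd z hz, hJN z hz]
  obtain ⟨g, hg, hgexp⟩ := exists_continuousOn_log_div hN hNo hKN hq hq'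
  have hne : ∀ z ∈ P ∪ J, z - ((-r : ℝ) : ℂ) * Complex.I ≠ 0 := fun z hz h0 =>
    hKN z hz (by rwa [sub_eq_zero.1 h0])
  set w : ℂ → ℂ := fun z => (z - (r : ℂ) * Complex.I) / (z - ((-r : ℝ) : ℂ) * Complex.I) with hw
  have hwc : ContinuousOn w (P ∪ J) := ContinuousOn.div (by fun_prop) (by fun_prop) hne
  -- off the segment `[-ri, ri]` the quotient `w` avoids the closed negative real axis
  have hslitP : ∀ z ∈ P, w z ∈ Complex.slitPlane := by
    intro z hz
    rw [Complex.mem_slitPlane_iff]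
    by_contra hcon
    push Not at hcon
    obtain ⟨hre0, him0⟩ := hcon
    set s : ℝ := -(w z).re with hs
    have hs0 : 0 ≤ s := by linarith
    have hwz : w z = ((-s : ℝ) : ℂ) := by
      apply Complex.ext <;> simp [hs, him0]
    rw [hw] at hwz
    simp only at hwz
    rw [div_eq_iff (hne z (Or.inl hz))] at hwz
    have h1 := congrArg Complex.re hwz
    have h2 := congrArg Complex.im hwz
    simp at h1 h2
    have hzre : z.re = 0 := by
      have : (1 + s) * z.re = 0 := by linarith
      rcases mul_eq_zero.1 this with h | h
      · linarith
      · exact h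
    have hzim : z.im * (1 + s) = r * (1 - s) := by linarith
    have hzI : z = (z.im : ℂ) * Complex.I := by apply Complex.ext <;> simp [hzre]
    by_cases h0 : z.im = 0
    · rw [h0] at hzI
      simp only [Complex.ofReal_zero, zero_mul] at hzI
      exact hP0 (hzI ▸ hz)
    · refine hd z hz ?_
      rw [hzI]
      refine him _ h0 (abs_le.2 ⟨?_, ?_⟩) <;> nlinarith
  have hslitJ : ∀ z ∈ J, -w z ∈ Complex.slitPlane := by
    intro z hz
    rw [Complex.mem_slitPlane_iff]
    by_contra hcon
    push Not at hcon
    obtain ⟨hre0, him0⟩ := hcon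
    have hwz : w z = ((w z).re : ℂ) := by
      apply Complex.ext
      · simp
      · simpa using him0
    have hs0 : 0 ≤ (w z).re := by simpa using hre0
    set s : ℝ := (w z).re with hs
    rw [hw] at hwz
    simp only at hwz
    rw [div_eq_iff (hne z (Or.inr hz))] at hwz
    obtain ⟨t, ht, rfl⟩ := hz
    have h2 := congrArg Complex.im hwz
    simp at h2
    nlinarith
  have hlogP := sub_eq_sub_of_exp_eq hP (hg.mono subset_union_left)
    (ContinuousOn.clog (hwc.mono subset_union_left) hslitP)
    (fun z hz => by
      rw [hgexp z (Or.inl hz), Complex.exp_log (Complex.slitPlane_ne_zero (hslitP z hz))])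
    hrP' hrP
  have hlogJ := sub_eq_sub_of_exp_eq hJc (hg.mono subset_union_right)
    (g₂ := fun z => Complex.log (-w z) + Real.pi * Complex.I)
    ((ContinuousOn.clog (hwc.mono subset_union_right).neg hslitJ).add continuousOn_const)
    (fun z hz => by
      rw [hgexp z (Or.inr hz), Complex.exp_add,
        Complex.exp_log (Complex.slitPlane_ne_zero (hslitJ z hz)), Complex.exp_pi_mul_I]
      simp [hw])
    (x := ((-r : ℝ) : ℂ)) (y := (r : ℂ)) ⟨-r, ⟨le_rfl, by linarith⟩, rfl⟩
    ⟨r, ⟨by linarith, le_rfl⟩, rfl⟩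
  have hw1 : w (r : ℂ) = -Complex.I := by
    simp only [hw]
    rw [div_eq_iff (hne _ (Or.inl hrP))]
    apply Complex.ext <;> simp
  have hw2 : w ((-r : ℝ) : ℂ) = Complex.I := by
    simp only [hw]
    rw [div_eq_iff (hne _ (Or.inl hrP'))]
    apply Complex.ext <;> simp
  rw [hw1, hw2, Complex.log_I, Complex.log_neg_I] at hlogP
  simp only [hw1, hw2, neg_neg, Complex.log_I, Complex.log_neg_I] at hlogJ
  have h1 := congrArg Complex.im hlogP
  have h2 := congrArg Complex.im hlogJ
  simp at h1 h2
  linarith [Real.pi_pos]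

/-! ### Second derivatives along lines and along sections of the graph -/

/-- Along a direction of positive second derivative a function lies strictly above its tangent. -/
theorem eventually_lt_of_second_fderiv_pos {E : Type*} [NormedAddCommGroup E] [NormedSpace ℝ E]
    {f : E → ℝ} (hf : ContDiff ℝ ∞ f) {z e : E} (h : 0 < fderiv ℝ (fderiv ℝ f) z e e) :
    ∀ᶠ t in 𝓝[≠] (0 : ℝ), f z + t * fderiv ℝ f z e < f (z + t • e) := by
  set k := fderiv ℝ (fderiv ℝ f) z e e with hk
  -- the excess over the tangent is compared with the parabola of half the curvature
  set φ : ℝ → ℝ := fun t => f (z + t • e) - t * fderiv ℝ f z e - k / 4 * t ^ 2 with hφ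
  have hline : ∀ t : ℝ, HasDerivAt (fun t : ℝ => z + t • e) e t := fun t => by
    simpa using ((hasDerivAt_id t).smul_const e).const_add z
  have hd : ∀ t, HasDerivAt φ (fderiv ℝ f (z + t • e) e - fderiv ℝ f z e - k / 2 * t) t := by
    intro t
    have h1 : HasDerivAt (fun t : ℝ => f (z + t • e)) (fderiv ℝ f (z + t • e) e) t :=
      ((hf.differentiable (by simp)) (z + t • e)).hasFDerivAt.comp_hasDerivAt t (hline t)
    have h2 := (h1.sub ((hasDerivAt_id t).mul_const (fderiv ℝ f z e))).sub
      (((hasDerivAt_id t).pow 2).const_mul (k / 4))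
    refine h2.congr_deriv ?_
    simp
    ring
  have hderiv : deriv φ = fun t => fderiv ℝ f (z + t • e) e - fderiv ℝ f z e - k / 2 * t :=
    funext fun t => (hd t).deriv
  have hdd : HasDerivAt (deriv φ) (k - k / 2) 0 := by
    rw [hderiv]
    have h0 : HasFDerivAt (fderiv ℝ f) (fderiv ℝ (fderiv ℝ f) z) (z + (0 : ℝ) • e) := by
      rw [zero_smul, add_zero]
      exact ((hf.fderiv_right (m := 1) (by norm_cast)).differentiable (by simp) z).hasFDerivAt
    have h1 : HasDerivAt (fun t : ℝ => fderiv ℝ f (z + t • e))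
        (fderiv ℝ (fderiv ℝ f) z e) 0 := h0.comp_hasDerivAt (0 : ℝ) (hline 0)
    have h2 : HasDerivAt (fun t : ℝ => fderiv ℝ f (z + t • e) e) k 0 := by
      simpa using h1.clm_apply (hasDerivAt_const (0 : ℝ) e)
    have h3 := (h2.sub_const (fderiv ℝ f z e)).fun_sub ((hasDerivAt_id (0 : ℝ)).const_mul (k / 2))
    simpa using h3
  have hmin : IsLocalMin φ 0 := by
    apply isLocalMin_of_deriv_deriv_pos
    · rw [hdd.deriv]; linarith
    · rw [hderiv]; simp
    · exact (hd 0).continuousAt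
  filter_upwards [nhdsWithin_le_nhds hmin, self_mem_nhdsWithin] with t ht ht0
  have h2 : 0 < t ^ 2 := by have : t ≠ 0 := ht0; positivity
  simp only [hφ, zero_smul, add_zero] at ht
  nlinarith

/-- If the curve `t ↦ (z + tβ + h(t)ν, c + tβ' + h(t)ν')`, with `h` vanishing to first order at `0`
and `h''(0) = k`, lies on the graph of `f`, then `(β, β')` is tangent to the graph and
`D²f(β, β)` is `k` times the defect of tangency of `(ν, ν')`. -/
theorem second_fderiv_of_curve {E : Type*} [NormedAddCommGroup E] [NormedSpace ℝ E]
    {f : E → ℝ} (hf : ContDiff ℝ ∞ f) {z β ν : E} {c β' ν' k : ℝ} {h h' : ℝ → ℝ}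
    (hh : ∀ᶠ t in 𝓝 (0 : ℝ), HasDerivAt h (h' t) t) (hh' : HasDerivAt h' k 0)
    (h0 : h 0 = 0) (h0' : h' 0 = 0)
    (hon : ∀ᶠ t in 𝓝 (0 : ℝ), f (z + t • β + h t • ν) = c + t * β' + h t * ν') :
    fderiv ℝ f z β = β' ∧ fderiv ℝ (fderiv ℝ f) z β β = k * (ν' - fderiv ℝ f z ν) := by
  set γ : ℝ → E := fun t => z + t • β + h t • ν with hγ
  have hγ0 : γ 0 = z := by simp [hγ, h0]
  have hγd : ∀ᶠ t in 𝓝 (0 : ℝ), HasDerivAt γ (β + h' t • ν) t := by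
    filter_upwards [hh] with t ht
    simpa using (((hasDerivAt_id t).smul_const β).const_add z).fun_add (ht.smul_const ν)
  have hfirst : ∀ᶠ t in 𝓝 (0 : ℝ), fderiv ℝ f (γ t) (β + h' t • ν) = β' + h' t * ν' := by
    filter_upwards [hh, hγd, eventually_eventually_nhds.2 hon] with t ht hγt hont
    have h1 : HasDerivAt (fun t => f (γ t)) (fderiv ℝ f (γ t) (β + h' t • ν)) t :=
      ((hf.differentiable (by simp)) (γ t)).hasFDerivAt.comp_hasDerivAt t hγt
    have h2 : HasDerivAt (fun t => c + t * β' + h t * ν') (β' + h' t * ν') t := by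
      simpa using (((hasDerivAt_id t).mul_const β').const_add c).fun_add (ht.mul_const ν')
    exact (h2.congr_of_eventuallyEq hont).unique h1 |>.symm
  refine ⟨by simpa [hγ0, h0'] using hfirst.self_of_nhds, ?_⟩
  have hF : HasFDerivAt (fderiv ℝ f) (fderiv ℝ (fderiv ℝ f) z) (γ 0) := by
    rw [hγ0]
    exact ((hf.fderiv_right (m := 1) (by norm_cast)).differentiable (by simp) z).hasFDerivAt
  have hγ' : HasDerivAt γ β 0 := by simpa [h0'] using hγd.self_of_nhds
  have h1 := (hF.comp_hasDerivAt (0 : ℝ) hγ').clm_apply ((hh'.smul_const ν).const_add β)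
  have h2 : HasDerivAt (fun t => β' + h' t * ν') (k * ν') 0 := (hh'.mul_const ν').const_add β'
  have h3 := (h2.congr_of_eventuallyEq hfirst).unique h1
  simp [h0', hγ0] at h3
  linarith

/-- In tangent-normal coordinates, the second derivative of `f` along the projection of the tangent
vector with coordinates `w` is the second derivative of `g` along `w`, up to a factor that does not
depend on `w`. -/
theorem IsTangentNormalChart.second_fderiv {f : ℝ × ℝ → ℝ} (hf : ContDiff ℝ ∞ f) {p : Space}
    {b : OrthonormalBasis (Fin 3) ℝ Space} {U : Set Space} {V : Set (ℝ × ℝ)} {g : ℝ × ℝ → ℝ}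
    (hc : IsTangentNormalChart (graphSurface f) p b U V g) (w : ℝ × ℝ) {v : Space}
    (hv : v = w.1 • b 0 + w.2 • b 1) :
    fderiv ℝ f (p 0, p 1) (v 0, v 1) = v 2 ∧
    fderiv ℝ (fderiv ℝ f) (p 0, p 1) (v 0, v 1) (v 0, v 1) =
      fderiv ℝ (fderiv ℝ g) (0, 0) w w *
        (b 2 2 - fderiv ℝ f (p 0, p 1) (b 2 0, b 2 1)) := by
  have hline : ∀ t : ℝ, HasDerivAt (fun t : ℝ => t • w) w t := fun t => by
    simpa using (hasDerivAt_id t).smul_const w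
  have hV0 : V ∈ 𝓝 ((0 : ℝ) • w) := by
    rw [zero_smul]; exact hc.isOpen_dom.mem_nhds hc.zero_mem_dom
  have hVt : ∀ᶠ t in 𝓝 (0 : ℝ), t • w ∈ V := (hline 0).continuousAt.eventually hV0
  have hg : ∀ x ∈ V, ContDiffAt ℝ ∞ g x := fun x hx =>
    hc.smooth.contDiffAt (hc.isOpen_dom.mem_nhds hx)
  refine second_fderiv_of_curve hf (c := p 2) (h := fun t => g (t • w))
    (h' := fun t => fderiv ℝ g (t • w) w) ?_ ?_ ?_ ?_ ?_
  · filter_upwards [hVt] with t ht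
    exact ((hg _ ht).differentiableAt (by simp)).hasFDerivAt.comp_hasDerivAt t (hline t)
  · have hF : HasFDerivAt (fderiv ℝ g) (fderiv ℝ (fderiv ℝ g) (0, 0)) ((0 : ℝ) • w) := by
      rw [zero_smul]
      exact (((hg _ hc.zero_mem_dom).fderiv_right (m := 1) (by norm_cast)).differentiableAt
        (by simp)).hasFDerivAt
    have h1 : HasDerivAt (fun t : ℝ => fderiv ℝ g (t • w))
        (fderiv ℝ (fderiv ℝ g) (0, 0) w) 0 := hF.comp_hasDerivAt (0 : ℝ) (hline 0)
    simpa using h1.clm_apply (hasDerivAt_const (0 : ℝ) w)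
  · rw [zero_smul]
    exact hc.map_zero
  · have := hc.fderiv_zero
    rw [show ((0 : ℝ), (0 : ℝ)) = 0 from rfl] at this
    simp [this]
  · filter_upwards [hVt] with t ht
    have hmem : p + (t • w).1 • b 0 + (t • w).2 • b 1 + g (t • w) • b 2 ∈ graphSurface f := by
      refine inter_subset_left (t := U) ?_
      rw [hc.inter_eq]
      exact ⟨t • w, ht, rfl⟩
    simp only [graphSurface, mem_ofPred_eq] at hmem
    subst hv
    simp at hmem ⊢
    ring_nf at hmem ⊢
    exact hmem.symm

/-- At every point of a strictly saddle graph the Hessian of `f` is indefinite. -/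
theorem exists_second_fderiv_pos_neg {f : ℝ × ℝ → ℝ} (hf : ContDiff ℝ ∞ f)
    (hs : IsStrictlySaddle (graphSurface f)) (z : ℝ × ℝ) :
    (∃ e, 0 < fderiv ℝ (fderiv ℝ f) z e e) ∧ ∃ e, fderiv ℝ (fderiv ℝ f) z e e < 0 := by
  obtain ⟨K, ⟨k₁, k₂, ⟨b, U, V, g, hc, hk₁, -, hk₂⟩, rfl⟩, hK⟩ :=
    hs (!₂[z.1, z.2, f z]) (by simp [graphSurface])
  obtain ⟨ht₁, hd₁⟩ := hc.second_fderiv hf (1, 0) (v := b 0) (by simp)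
  obtain ⟨ht₂, hd₂⟩ := hc.second_fderiv hf (0, 1) (v := b 1) (by simp)
  rw [hk₁] at hd₁
  rw [hk₂] at hd₂
  have hz : ((!₂[z.1, z.2, f z] : Space) 0, (!₂[z.1, z.2, f z] : Space) 1) = z := by simp
  rw [hz] at ht₁ ht₂ hd₁ hd₂
  set δ : ℝ := b 2 2 - fderiv ℝ f z (b 2 0, b 2 1) with hδ
  -- were the normal `b 2` tangent to the graph, every vector would be, also the vertical one
  have hδ0 : δ ≠ 0 := by
    intro h0
    let T : Space →L[ℝ] ℝ := EuclideanSpace.proj 2 -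
      (fderiv ℝ f z).comp ((EuclideanSpace.proj 0).prod (EuclideanSpace.proj 1))
    have hT : ∀ v : Space, T v = v 2 - fderiv ℝ f z (v 0, v 1) := fun v => rfl
    have hT0 : (T : Space →ₗ[ℝ] ℝ) = 0 := by
      refine b.toBasis.ext fun i => ?_
      fin_cases i
      · simp [hT, ht₁]
      · simp [hT, ht₂]
      · simpa [hT] using h0
    have h1 : T (!₂[0, 0, 1]) = 0 := congrArg (fun F : Space →ₗ[ℝ] ℝ => F !₂[0, 0, 1]) hT0
    rw [hT] at h1
    have h2 : fderiv ℝ f z ((0 : ℝ), (0 : ℝ)) = 0 := map_zero _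
    simp [h2] at h1
  rcases mul_neg_iff.1 hK with ⟨h1, h2⟩ | ⟨h1, h2⟩ <;> rcases lt_or_gt_of_ne hδ0 with h3 | h3
  · exact ⟨⟨_, hd₂ ▸ mul_pos_of_neg_of_neg h2 h3⟩, ⟨_, hd₁ ▸ mul_neg_of_pos_of_neg h1 h3⟩⟩
  · exact ⟨⟨_, hd₁ ▸ mul_pos h1 h3⟩, ⟨_, hd₂ ▸ mul_neg_of_neg_of_pos h2 h3⟩⟩
  · exact ⟨⟨_, hd₁ ▸ mul_pos_of_neg_of_neg h1 h3⟩, ⟨_, hd₂ ▸ mul_neg_of_pos_of_neg h2 h3⟩⟩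
  · exact ⟨⟨_, hd₂ ▸ mul_pos h2 h3⟩, ⟨_, hd₁ ▸ mul_neg_of_neg_of_pos h1 h3⟩⟩

/-! ### Superlevel sets relative to linear functions -/

/-- The compactness behind the maximum principle: a closed subset of the plane on which two linear
functions, orthogonal to each other, are bounded is compact. -/
theorem isCompact_of_bounded_coordinates {a b : ℝ} (hab : a ^ 2 + b ^ 2 ≠ 0) {S : Set (ℝ × ℝ)}
    (hS : IsClosed S) {A B : ℝ} (hL : ∀ z ∈ S, |a * z.1 + b * z.2| ≤ A)
    (hM : ∀ z ∈ S, |a * z.2 - b * z.1| ≤ B) : IsCompact S := by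
  have hK : IsCompact ((fun w : ℝ × ℝ => ((a * w.1 - b * w.2) / (a ^ 2 + b ^ 2),
      (b * w.1 + a * w.2) / (a ^ 2 + b ^ 2))) '' (Icc (-A) A ×ˢ Icc (-B) B)) :=
    (isCompact_Icc.prod isCompact_Icc).image (by fun_prop)
  refine hK.of_isClosed_subset hS fun z hz => ⟨(a * z.1 + b * z.2, a * z.2 - b * z.1),
    ⟨abs_le.1 (hL z hz), abs_le.1 (hM z hz)⟩, ?_⟩
  ext <;> simp only <;> field_simp <;> ring

/-- Maximum principle on half of a strip-like domain. Let `u` be bounded on `Ω` and nonpositive on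
its frontier, and suppose that subtracting a linear function from `u` never creates a local
maximum. Then on the side `M ≥ m` of `Ω` the function `u` is bounded by its bound on the section
`M = m`: compare it with `ε (M - m)` and let `ε` tend to `0`. -/
theorem le_of_section_bound {u : ℝ × ℝ → ℝ} (hu : Continuous u)
    (hmax : ∀ (A : ℝ × ℝ →L[ℝ] ℝ) (z : ℝ × ℝ), ¬ IsLocalMax (fun w => u w - A w) z)
    {Ω : Set (ℝ × ℝ)} (hΩ : IsOpen Ω) (hfr : ∀ z ∈ closure Ω, z ∉ Ω → u z ≤ 0)
    {B : ℝ} (hB : ∀ z ∈ closure Ω, u z ≤ B) (M : ℝ × ℝ →L[ℝ] ℝ) {m s : ℝ} (hs : 0 ≤ s)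
    (hcpt : ∀ T, IsCompact (closure Ω ∩ M ⁻¹' Icc m T))
    (hsec : ∀ z ∈ closure Ω, M z = m → u z ≤ s) {z : ℝ × ℝ} (hz : z ∈ Ω) (hzm : m ≤ M z) :
    u z ≤ s := by
  have key : ∀ ε > 0, u z ≤ s + ε * (M z - m) := by
    intro ε hε
    set T := max (M z) (m + (|B| + 1) / ε) with hT
    have hTB : B < ε * (T - m) := by
      have h1 : (|B| + 1) / ε ≤ T - m := by linarith [le_max_right (M z) (m + (|B| + 1) / ε)]
      rw [div_le_iff₀ hε] at h1
      nlinarith [le_abs_self B]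
    obtain ⟨y, ⟨hyc, hyM⟩, hymax⟩ := (hcpt T).exists_isMaxOn
      ⟨z, subset_closure hz, hzm, le_max_left _ _⟩
      (f := fun w => u w - (ε • M) w) (by fun_prop)
    have hle : u z - ε * M z ≤ u y - ε * M y := by
      simpa using hymax (show z ∈ closure Ω ∩ M ⁻¹' Icc m T from
        ⟨subset_closure hz, hzm, le_max_left _ _⟩)
    obtain ⟨hy1, hy2⟩ := hyM
    by_cases hyΩ : y ∈ Ω
    · rcases hy1.eq_or_lt with h1 | h1
      · have := hsec y hyc h1.symm
        rw [← h1] at hle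
        linarith
      · rcases hy2.eq_or_lt with h2 | h2
        · have := hB y hyc
          rw [h2] at hle
          linarith
        · refine (hmax (ε • M) y ?_).elim
          have hnhd : Ω ∩ M ⁻¹' Ioo m T ∈ 𝓝 y :=
            (hΩ.inter (isOpen_Ioo.preimage M.continuous)).mem_nhds ⟨hyΩ, h1, h2⟩
          filter_upwards [hnhd] with w hw
          exact hymax ⟨subset_closure hw.1, hw.2.1.le, hw.2.2.le⟩
    · have := hfr y hyc hyΩ
      have h1 : 0 ≤ ε * (M y - m) := mul_nonneg hε.le (by linarith)
      linarith
  have hlim : Tendsto (fun ε : ℝ => s + ε * (M z - m)) (𝓝[>] 0) (𝓝 s) := by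
    have : Tendsto (fun ε : ℝ => s + ε * (M z - m)) (𝓝 0) (𝓝 (s + 0 * (M z - m))) :=
      Continuous.tendsto (by fun_prop) 0
    simpa using this.mono_left nhdsWithin_le_nhds
  exact ge_of_tendsto hlim (eventually_mem_nhdsWithin.mono fun ε hε => key ε hε)

/-- A bounded function that has no local maximum relative to any linear function exceeds each
nonconstant affine function on a connected set. Otherwise the set where it does has a component
`Ω` disjoint from the half plane where `L + c < -C`. This `Ω` lies in a
strip, and by the maximum principle the difference attains its maximum over `Ω`. -/
theorem isPreconnected_superlevel {f : ℝ × ℝ → ℝ} (hf : Continuous f)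
    (hmax : ∀ (A : ℝ × ℝ →L[ℝ] ℝ) (z : ℝ × ℝ), ¬ IsLocalMax (fun w => f w - A w) z)
    {C : ℝ} (hC : ∀ z, |f z| ≤ C) {L : ℝ × ℝ →L[ℝ] ℝ} (hL : L ≠ 0) (c : ℝ) :
    IsPreconnected {z | c < f z - L z} := by
  set P : Set (ℝ × ℝ) := {z | c < f z - L z} with hP
  have hPo : IsOpen P := isOpen_lt continuous_const (hf.sub L.continuous)
  set H : Set (ℝ × ℝ) := {z | L z < -C - c} with hH
  have hHP : H ⊆ P := by
    intro z hz
    have h1 := (abs_le.1 (hC z)).1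
    simp only [hH, hP, mem_ofPred_eq] at hz ⊢
    linarith
  have hHc : IsPreconnected H :=
    (convex_halfSpace_lt L.toLinearMap.isLinear (-C - c)).isPreconnected
  set a := L (1, 0) with ha
  set b := L (0, 1) with hb
  have hLab : ∀ z : ℝ × ℝ, L z = a * z.1 + b * z.2 := by
    intro z
    have : z = z.1 • ((1 : ℝ), (0 : ℝ)) + z.2 • ((0 : ℝ), (1 : ℝ)) := by ext <;> simp
    rw [this, map_add, map_smul, map_smul]
    simp [ha, hb, mul_comm]
  have hab : a ^ 2 + b ^ 2 ≠ 0 := by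
    intro h0
    have ha0 : a = 0 := by nlinarith [sq_nonneg a, sq_nonneg b]
    have hb0 : b = 0 := by nlinarith [sq_nonneg a, sq_nonneg b]
    exact hL (ContinuousLinearMap.ext fun z => by rw [hLab, ha0, hb0]; simp)
  have hmeet : ∀ z₀ ∈ P, (connectedComponentIn P z₀ ∩ H).Nonempty := by
    intro z₀ hz₀
    by_contra hempty
    set Ω := connectedComponentIn P z₀ with hΩdef
    have hΩo : IsOpen Ω := hPo.connectedComponentIn
    have hΩP : Ω ⊆ P := connectedComponentIn_subset P z₀
    have hz₀Ω : z₀ ∈ Ω := mem_connectedComponentIn hz₀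
    set u : ℝ × ℝ → ℝ := fun z => f z - L z - c with hu
    have huc : Continuous u := by fun_prop
    have humax : ∀ (A : ℝ × ℝ →L[ℝ] ℝ) (z : ℝ × ℝ), ¬ IsLocalMax (fun w => u w - A w) z := by
      intro A z hloc
      refine hmax (L + A) z ?_
      filter_upwards [hloc] with w hw
      simp only [hu, add_apply] at hw ⊢
      linarith
    have hfr : ∀ z ∈ closure Ω, z ∉ Ω → u z ≤ 0 := by
      intro z hz hzΩ
      by_contra hpos
      have hzP : z ∈ P := by simp only [hP, hu, mem_ofPred_eq] at hpos ⊢; linarith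
      obtain ⟨y, hy1, hy2⟩ := mem_closure_iff.1 hz _ hPo.connectedComponentIn
        (mem_connectedComponentIn hzP)
      apply hzΩ
      rw [hΩdef, connectedComponentIn_eq hy2, ← connectedComponentIn_eq hy1]
      exact mem_connectedComponentIn hzP
    have hstrip : ∀ z ∈ closure Ω, -C - c ≤ L z ∧ L z ≤ C - c := by
      have hcl : IsClosed {z | -C - c ≤ L z ∧ L z ≤ C - c} :=
        (isClosed_le continuous_const L.continuous).inter
          (isClosed_le L.continuous continuous_const)
      refine fun z hz => closure_minimal ?_ hcl hz
      intro z hz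
      have h1 : c < f z - L z := hΩP hz
      have h2 := (abs_le.1 (hC z)).2
      have h3 : ¬ L z < -C - c := fun h => hempty ⟨z, hz, h⟩
      exact ⟨not_lt.1 h3, by linarith⟩
    have hB : ∀ z ∈ closure Ω, u z ≤ 2 * C := by
      intro z hz
      have h1 := (hstrip z hz).1
      have h2 := (abs_le.1 (hC z)).2
      simp only [hu]
      linarith
    -- `M` is the linear coordinate along the strip
    set M : ℝ × ℝ →L[ℝ] ℝ := a • ContinuousLinearMap.snd ℝ ℝ ℝ - b • ContinuousLinearMap.fst ℝ ℝ ℝ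
      with hM
    have hMab : ∀ z : ℝ × ℝ, M z = a * z.2 - b * z.1 := fun z => by simp [hM]
    have hcpt : ∀ s t : ℝ, IsCompact (closure Ω ∩ M ⁻¹' Icc s t) := by
      intro s t
      refine isCompact_of_bounded_coordinates hab (A := |C| + |c|) (B := |s| + |t|)
        (isClosed_closure.inter (isClosed_Icc.preimage M.continuous)) ?_ ?_
      · rintro z ⟨hz, -⟩
        obtain ⟨h1, h2⟩ := hstrip z hz
        rw [← hLab, abs_le]
        constructor <;>
          linarith [le_abs_self C, le_abs_self c, neg_abs_le c, neg_abs_le C]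
      · rintro z ⟨-, h1, h2⟩
        rw [← hMab, abs_le]
        constructor <;>
          linarith [le_abs_self s, le_abs_self t, neg_abs_le s, neg_abs_le t, abs_nonneg s,
            abs_nonneg t]
    have hu₀ : 0 < u z₀ := by
      have : c < f z₀ - L z₀ := hz₀
      simp only [hu]; linarith
    obtain ⟨z₁, ⟨hz₁c, hz₁M⟩, hz₁max⟩ := (hcpt (M z₀) (M z₀)).exists_isMaxOn
      ⟨z₀, subset_closure hz₀Ω, le_rfl, le_rfl⟩ huc.continuousOn
    have hz₁pos : 0 < u z₁ :=
      hu₀.trans_le (hz₁max ⟨subset_closure hz₀Ω, le_rfl, le_rfl⟩)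
    have hz₁Ω : z₁ ∈ Ω := by
      by_contra h
      exact absurd (hfr z₁ hz₁c h) (not_le.2 hz₁pos)
    have hsec : ∀ z ∈ closure Ω, M z = M z₀ → u z ≤ u z₁ := fun z hz hzM =>
      hz₁max ⟨hz, hzM.ge, hzM.le⟩
    refine humax 0 z₁ ?_
    filter_upwards [hΩo.mem_nhds hz₁Ω] with z hz
    simp only [zero_apply, sub_zero]
    rcases le_total (M z₀) (M z) with hle | hle
    · exact le_of_section_bound huc humax hΩo hfr hB M hz₁pos.le (hcpt _) hsec hz hle
    · refine le_of_section_bound huc humax hΩo hfr hB (-M) (m := -M z₀) hz₁pos.le ?_ ?_ hz ?_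
      · intro T
        convert hcpt (-T) (M z₀) using 2
        ext w
        simp only [mem_preimage, mem_Icc, neg_apply]
        constructor <;> rintro ⟨h1, h2⟩ <;> constructor <;> linarith
      · intro w hw hwM
        exact hsec w hw (by simpa using hwM)
      · simpa using hle
  rcases P.eq_empty_or_nonempty with hPe | ⟨z₀, hz₀⟩
  · rw [hPe]; exact isPreconnected_empty
  · obtain ⟨h, -, hh⟩ := hmeet z₀ hz₀
    have hPeq : P = connectedComponentIn P h := by
      refine Subset.antisymm (fun z hz => ?_) (connectedComponentIn_subset _ _)
      obtain ⟨k, hk1, hk2⟩ := hmeet z hz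
      have h1 : k ∈ connectedComponentIn P h := hHc.subset_connectedComponentIn hh hHP hk2
      rw [connectedComponentIn_eq h1, ← connectedComponentIn_eq hk1]
      exact mem_connectedComponentIn hz
    rw [hPeq]
    exact isPreconnected_connectedComponentIn

/-- A function that lies strictly above its tangent along some line through `z` has no local maximum
at `z` relative to any linear function: on one of the two sides of `z` the linear part does not
decrease. -/
theorem not_isLocalMax_sub_of_eventually_lt {f : ℝ × ℝ → ℝ} {z e : ℝ × ℝ} {d : ℝ}
    (h : ∀ᶠ t in 𝓝[≠] (0 : ℝ), f z + t * d < f (z + t • e)) (A : ℝ × ℝ →L[ℝ] ℝ) :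
    ¬ IsLocalMax (fun w => f w - A w) z := by
  intro hloc
  have hneg : Tendsto (fun t : ℝ => -t) (𝓝[≠] 0) (𝓝[≠] 0) := by
    refine tendsto_nhdsWithin_iff.2 ⟨?_, ?_⟩
    · have : Tendsto (fun t : ℝ => -t) (𝓝 0) (𝓝 0) := by
        simpa using continuous_neg.tendsto (0 : ℝ)
      exact this.mono_left nhdsWithin_le_nhds
    · filter_upwards [self_mem_nhdsWithin] with t ht
      simpa using ht
  have hline : Tendsto (fun t : ℝ => z + t • e) (𝓝[≠] 0) (𝓝 z) := by
    have : Tendsto (fun t : ℝ => z + t • e) (𝓝 0) (𝓝 (z + (0 : ℝ) • e)) :=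
      Continuous.tendsto (by fun_prop) 0
    rw [zero_smul, add_zero] at this
    exact this.mono_left nhdsWithin_le_nhds
  obtain ⟨t, h1, h2, h3, h4⟩ := (h.and ((hneg.eventually h).and
    ((hline.eventually hloc).and ((hline.comp hneg).eventually hloc)))).exists
  simp at h2 h3 h4
  linarith

/-! ### Unboundedness -/

/-- Two disjoint preconnected plane sets, one of them open, cannot cross at a point along two
line segments. -/
theorem false_of_cross_directions {P N : Set (ℝ × ℝ)} (hP : IsPreconnected P)
    (hN : IsPreconnected N) (hNo : IsOpen N) (hd : ∀ z ∈ P, z ∉ N) {p e₁ e₂ : ℝ × ℝ}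
    (hpP : p ∉ P) (hpN : p ∉ N) (h₁ : ∀ᶠ t in 𝓝[≠] (0 : ℝ), p + t • e₁ ∈ P)
    (h₂ : ∀ᶠ t in 𝓝[≠] (0 : ℝ), p + t • e₂ ∈ N) : False := by
  obtain ⟨r, hr, hball⟩ := Metric.mem_nhdsWithin_iff.1 (h₁.and h₂)
  have hsmall : ∀ t : ℝ, t ≠ 0 → |t| ≤ r / 2 → p + t • e₁ ∈ P ∧ p + t • e₂ ∈ N := by
    intro t ht0 ht
    refine hball ⟨?_, ht0⟩
    rw [Metric.mem_ball, dist_zero_right, Real.norm_eq_abs]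
    linarith
  set D : ℝ := e₁.1 * e₂.2 - e₁.2 * e₂.1 with hD
  have hD0 : D ≠ 0 := by
    intro h0
    -- parallel directions would share a small nonzero vector
    obtain ⟨s, t, hs, ht, hst⟩ : ∃ s t : ℝ, s ≠ 0 ∧ t ≠ 0 ∧ s • e₁ = t • e₂ := by
      have hz₁ : e₁ ≠ 0 := fun h => hpP (by
        simpa [h] using (hsmall (r / 2) (by linarith) (abs_of_pos (by linarith)).le).1)
      have hz₂ : e₂ ≠ 0 := fun h => hpN (by
        simpa [h] using (hsmall (r / 2) (by linarith) (abs_of_pos (by linarith)).le).2)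
      by_cases hx : e₁.1 = 0
      · have hy : e₁.2 ≠ 0 := fun hy => hz₁ (Prod.ext hx hy)
        have hx₂ : e₂.1 = 0 := by
          rw [hD, hx] at h0
          simpa [hy] using h0
        have hy₂ : e₂.2 ≠ 0 := fun hy => hz₂ (Prod.ext hx₂ hy)
        exact ⟨e₂.2, e₁.2, hy₂, hy, by ext <;> simp [hx, hx₂, mul_comm]⟩
      · have hx₂ : e₂.1 ≠ 0 := by
          intro hx₂
          rw [hD, hx₂] at h0
          exact hz₂ (Prod.ext hx₂ (by simpa [hx] using h0))
        exact ⟨e₂.1, e₁.1, hx₂, hx, by ext <;> simp <;> linarith⟩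
    set k : ℝ := r / 2 / (|s| + |t|) with hk
    have hst0 : 0 < |s| + |t| := by positivity
    have hk0 : 0 < k := by positivity
    have hkst : k * (|s| + |t|) = r / 2 := div_mul_cancel₀ _ hst0.ne'
    have h3 := (hsmall (k * s) (by positivity) (by
      rw [abs_mul, abs_of_pos hk0]; nlinarith [abs_nonneg t])).1
    have h4 := (hsmall (k * t) (by positivity) (by
      rw [abs_mul, abs_of_pos hk0]; nlinarith [abs_nonneg s])).2
    rw [mul_smul, hst, ← mul_smul] at h3
    exact hd _ h3 h4
  -- linear coordinates with origin `p` and axes `e₁`, `e₂`, and their inverse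
  set Φ : ℂ → ℝ × ℝ := fun w => p + w.re • e₁ + w.im • e₂ with hΦ
  set Ψ : ℝ × ℝ → ℂ := fun z =>
    ⟨((z.1 - p.1) * e₂.2 - (z.2 - p.2) * e₂.1) / D,
      (e₁.1 * (z.2 - p.2) - e₁.2 * (z.1 - p.1)) / D⟩ with hΨ
  have hΦc : Continuous Φ := by
    have h1 := Complex.continuous_re
    have h2 := Complex.continuous_im
    fun_prop
  have hΨc : Continuous Ψ := by
    have : Ψ = fun z => Complex.equivRealProdCLM.symm
        (((z.1 - p.1) * e₂.2 - (z.2 - p.2) * e₂.1) / D,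
          (e₁.1 * (z.2 - p.2) - e₁.2 * (z.1 - p.1)) / D) := by
      funext z
      apply Complex.ext <;> simp [hΨ]
    rw [this]
    fun_prop
  have hΦΨ : ∀ z, Φ (Ψ z) = z := by
    intro z
    ext <;> simp only [hΦ, hΨ, Prod.fst_add, Prod.snd_add, Prod.smul_fst, Prod.smul_snd,
      smul_eq_mul] <;> field_simp <;> rw [hD] <;> ring
  have hΨΦ : ∀ w, Ψ (Φ w) = w := by
    intro w
    apply Complex.ext <;> simp only [hΦ, hΨ, Prod.fst_add, Prod.snd_add, Prod.smul_fst,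
      Prod.smul_snd, smul_eq_mul] <;> rw [div_eq_iff hD0, hD] <;> ring
  have himg : ∀ S : Set (ℝ × ℝ), Ψ '' S = Φ ⁻¹' S := fun S =>
    congrFun (image_eq_preimage_of_inverse hΦΨ hΨΦ) S
  have hP' : IsPreconnected (Φ ⁻¹' P) := himg P ▸ hP.image _ hΨc.continuousOn
  have hN' : IsPreconnected (Φ ⁻¹' N) := himg N ▸ hN.image _ hΨc.continuousOn
  refine false_of_cross hP' hN' (hNo.preimage hΦc) (fun z hz => hd _ hz) ?_ ?_ (half_pos hr) ?_ ?_
  · simpa [hΦ] using hpP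
  · simpa [hΦ] using hpN
  · intro t ht0 ht
    simpa [hΦ] using (hsmall t ht0 ht).1
  · intro t ht0 ht
    simpa [hΦ] using (hsmall t ht0 ht).2

theorem mainTheorem2 (f : ℝ × ℝ → ℝ) (hf : ContDiff ℝ ∞ f)
    (hs : IsStrictlySaddle (graphSurface f)) :
    ¬ ∃ C : ℝ, ∀ x y : ℝ, |f (x, y)| ≤ C := by
  rintro ⟨C, hC⟩
  have hpos : ∀ z, ∃ e, ∀ᶠ t in 𝓝[≠] (0 : ℝ), f z + t * fderiv ℝ f z e < f (z + t • e) := by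
    intro z
    obtain ⟨⟨e, he⟩, -⟩ := exists_second_fderiv_pos_neg hf hs z
    exact ⟨e, eventually_lt_of_second_fderiv_pos hf he⟩
  have hneg : ∀ z, ∃ e, ∀ᶠ t in 𝓝[≠] (0 : ℝ),
      -f z + t * -fderiv ℝ f z e < -f (z + t • e) := by
    intro z
    obtain ⟨-, e, he⟩ := exists_second_fderiv_pos_neg hf hs z
    have hd : fderiv ℝ (fun w => -f w) = fun w => -fderiv ℝ f w := funext fun w => fderiv_fun_neg
    have h2 := eventually_lt_of_second_fderiv_pos hf.neg (z := z) (e := e) (by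
      rw [hd, fderiv_fun_neg]; simpa using he)
    rw [hd] at h2
    exact ⟨e, by simpa using h2⟩
  have hmax : ∀ (A : ℝ × ℝ →L[ℝ] ℝ) (z : ℝ × ℝ), ¬ IsLocalMax (fun w => f w - A w) z :=
    fun A z => (hpos z).elim fun _ he => not_isLocalMax_sub_of_eventually_lt he A
  have hmax' : ∀ (A : ℝ × ℝ →L[ℝ] ℝ) (z : ℝ × ℝ), ¬ IsLocalMax (fun w => -f w - A w) z :=
    fun A z => (hneg z).elim fun _ he =>
      not_isLocalMax_sub_of_eventually_lt (f := fun w => -f w) he A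
  -- a constant function has local maxima, so some tangent plane is not horizontal
  obtain ⟨p, hp⟩ : ∃ p, fderiv ℝ f p ≠ 0 := by
    by_contra! hall
    refine hmax 0 0 (Eventually.of_forall fun w => ?_)
    simp [is_const_of_fderiv_eq_zero (hf.differentiable (by simp)) hall w 0]
  obtain ⟨e₁, h₁⟩ := hpos p
  obtain ⟨e₂, h₂⟩ := hneg p
  set L := fderiv ℝ f p with hL
  have hP := isPreconnected_superlevel hf.continuous hmax (fun z => hC z.1 z.2) hp (f p - L p)
  have hN := isPreconnected_superlevel (f := fun w => -f w) hf.continuous.neg hmax'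
    (fun z => by rw [abs_neg]; exact hC z.1 z.2) (neg_ne_zero.2 hp) (-(f p - L p))
  refine false_of_cross_directions hP hN (p := p) (e₁ := e₁) (e₂ := e₂)
    (isOpen_lt continuous_const (hf.continuous.neg.sub (-L).continuous)) ?_ ?_ ?_ ?_ ?_
  · intro z hz hz'
    simp only [mem_ofPred_eq, neg_apply] at hz hz'
    linarith
  · simp
  · simp
  · filter_upwards [h₁] with t ht
    simp only [map_add, map_smul, smul_eq_mul]
    linarith
  · filter_upwards [h₂] with t ht
    simp only [neg_apply, map_add, map_smul, smul_eq_mul]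
    linarith
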